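/- Let $G$ be a finite noncyclic nilpotent group of order $n=p_1^{\alpha_1}p_2^{\alpha_2}\cdots p_r^{\alpha_r}$, where $r\geq 2$, $p_1<p_2<\cdots<p_r$ are primes and $\alpha_1,\ldots,\alpha_r\geq 1$. Write $[r]=\{1,\ldots,r\}$, let $P_i$ be the unique Sylow $p_i$-subgroup of $G$, and let $J=\{i\in[r]: P_i\text{ is noncyclic}\}$. Suppose that the center $Z(P_j)$ is noncyclic for every $j\in J$. Let $\mathcal{P}(G)$ be the power graph of $G$, that is, the simple graph with vertex set $G$ in which two distinct vertices are adjacent if and only if one of them is a positive power of the other; let $\deg(x)$ be the degree of a vertex $x$ and $\delta(\mathcal{P}(G))$ the minimum degree of this graph. A maximal cyclic subgroup of $G$ is a cyclic subgroup not properly contained in any cyclic subgroup of $G$; let $\mathcal{M}(G)$ be the set of all of them. Let $\phi$ denote Euler's totient function. Then the following hold. (i) If $J\neq[r]$ and $2\phi\left(\prod_{i\in[r]}p_i\right)\geq\prod_{i\in[r]}p_i$, then there exists $k\in[r]\setminus J$ such that $\delta(\mathcal{P}(G))=\deg\left(y^{p_k^{\alpha_k}}\right)$ for every $y\in G$ such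 that $\langle y\rangle\in\mathcal{M}(G)$ and $\langle y\rangle$ is of minimum order among the elements of $\mathcal{M}(G)$. (ii) If $J=[r]$ and $2\phi\left(\prod_{i\in[r]\setminus\{l\}}p_i\right)\geq\prod_{i\in[r]\setminus\{l\}}p_i$ for every $l\in[r]$, then $\delta(\mathcal{P}(G))=\deg(y)$ for every $y\in G$ such that $\langle y\rangle\in\mathcal{M}(G)$ and $\langle y\rangle$ is of minimum order among the elements of $\mathcal{M}(G)$. -/

import Mathlib

/-- The power graph of a group: distinct elements are adjacent iff one of them is a positive
power of the other. -/
def powerGraph (G : Type*) [Group G] : SimpleGraph G :=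
  SimpleGraph.fromRel fun x y => ∃ m : ℕ, 0 < m ∧ y = x ^ m

/-- A maximal cyclic subgroup: a cyclic subgroup not properly contained in any cyclic subgroup. -/
def IsMaximalCyclic {G : Type*} [Group G] (M : Subgroup G) : Prop :=
  Maximal (fun H : Subgroup G => IsCyclic H) M

/-- A maximal cyclic subgroup whose order is minimum among all maximal cyclic subgroups. -/
def IsMinOrderMaximalCyclic {G : Type*} [Group G] (M : Subgroup G) : Prop :=
  IsMaximalCyclic M ∧ ∀ K : Subgroup G, IsMaximalCyclic K → Nat.card M ≤ Nat.card K

open scoped Classical in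
/-- The prime divisors of the order of `G` for which a Sylow subgroup is noncyclic (in a finite
nilpotent group there is exactly one Sylow `p`-subgroup for each prime `p`). -/
noncomputable def noncyclicPrimes (G : Type*) [Group G] : Finset ℕ :=
  (Nat.card G).primeFactors.filter fun p => ∃ P : Sylow p G, ¬ IsCyclic (P : Subgroup G)

/-!
Write `r(x)` for the number of elements having `x` as a power. The closed neighbourhood of `x` in
the power graph has `o(x) + r(x) - φ(o(x))` elements, and since `G` is the direct product of its
Sylow subgroups, `o`, `φ ∘ o` and `r` are all products over the primes dividing `|G|`. If `⟨y⟩` is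
maximal cyclic, its closed neighbourhood is `⟨y⟩` itself.

Let `⟨y⟩` be maximal cyclic of minimum order, and suppose that a component `x_l` of `x` has smaller
order than `y_l`. If `Z(P_l)` is noncyclic, it contains an element `z` of order `p_l` outside a
maximal cyclic subgroup `⟨w⟩ ∋ x_l`. Every `c s` with `c ∈ ⟨z⟩` and `s ∈ ⟨w⟩ \ ⟨x_l⟩` satisfies
`(c s) ^ p_l = s ^ p_l`, so it has `x_l` as a power; hence `r(x) ≥ p_l φ(o(y))`. The bound
`n ≤ 2 φ(n)` depends only on the primes dividing `n` and passes to subsets of them, so `r(x)` can be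
compared with `o(y)`, which settles (ii) unless `x_l` is the only small component.

In (i) the candidate `y ^ p_k ^ α_k` generates the same subgroup as `y` with the component in a
cyclic `P_k` replaced by `1`. If `x_k` is the only small component, the two vertices are compared
through the other components alone; if two components in cyclic Sylow subgroups are small, the
candidate for the larger of the two primes has degree at most that of `x`.
-/

open Function (update update_self update_of_ne update_eq_self)
open Subgroup
open scoped Pointwise

section CyclicSubgroups

variable {G H : Type*} [Group G] [Group H]

/-- The number of elements of which `x` is a power, `x` itself included. Integer powers are allowed;
in a finite group they are the positive powers of the definition of `powerGraph`. -/
noncomputable def rootCount (x : G) : ℕ := {y | x ∈ zpowers y}.ncard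

/-- The size of the closed neighbourhood of `x` in the power graph of a finite group: one more than
the degree. Counting `x` itself is what makes it equal to `orderOf x` for maximal cyclic `⟨x⟩`. -/
noncomputable def closedDegree (x : G) : ℕ := {y | y ∈ zpowers x ∨ x ∈ zpowers y}.ncard

theorem isMaximalCyclic_zpowers_iff {y : G} :
    IsMaximalCyclic (zpowers y) ↔ ∀ z, y ∈ zpowers z → z ∈ zpowers y := by
  refine ⟨fun h z hz => zpowers_le.1 (h.2 (isCyclic_zpowers z) (zpowers_le.2 hz)), fun h => ?_⟩
  refine ⟨isCyclic_zpowers y, fun H hH hle => ?_⟩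
  obtain ⟨z, rfl⟩ := (H.isCyclic_iff_exists_zpowers_eq_top).1 hH
  exact zpowers_le.2 (h z (zpowers_le.1 hle))

theorem IsMaximalCyclic.exists_zpowers_eq {M : Subgroup G} (hM : IsMaximalCyclic M) :
    ∃ y, zpowers y = M :=
  (M.isCyclic_iff_exists_zpowers_eq_top).1 hM.1

theorem isMinOrderMaximalCyclic_zpowers_iff {y : G} :
    IsMinOrderMaximalCyclic (zpowers y) ↔ IsMaximalCyclic (zpowers y) ∧
      ∀ z : G, IsMaximalCyclic (zpowers z) → orderOf y ≤ orderOf z := by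
  simp only [← Nat.card_zpowers]
  refine and_congr_right fun _ => ⟨fun h z => h (zpowers z), fun h K hK => ?_⟩
  obtain ⟨z, rfl⟩ := hK.exists_zpowers_eq
  exact h z hK

theorem mem_zpowers_mulEquiv_iff (e : G ≃* H) {x y : G} : e x ∈ zpowers (e y) ↔ x ∈ zpowers y := by
  simp only [mem_zpowers_iff, ← map_zpow, e.injective.eq_iff]

theorem isMaximalCyclic_zpowers_mulEquiv_iff (e : G ≃* H) {y : G} :
    IsMaximalCyclic (zpowers (e y)) ↔ IsMaximalCyclic (zpowers y) := by
  simp only [isMaximalCyclic_zpowers_iff,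
    ← e.toEquiv.forall_congr_right (q := fun z => e y ∈ _ → z ∈ _),
    MulEquiv.toEquiv_eq_coe, MulEquiv.coe_toEquiv, mem_zpowers_mulEquiv_iff]

theorem isMinOrderMaximalCyclic_zpowers_mulEquiv_iff (e : G ≃* H) {y : G} :
    IsMinOrderMaximalCyclic (zpowers (e y)) ↔ IsMinOrderMaximalCyclic (zpowers y) := by
  simp only [isMinOrderMaximalCyclic_zpowers_iff, isMaximalCyclic_zpowers_mulEquiv_iff,
    ← e.toEquiv.forall_congr_right (q := fun z => IsMaximalCyclic (zpowers z) → _),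
    MulEquiv.toEquiv_eq_coe, MulEquiv.coe_toEquiv, MulEquiv.orderOf_eq]

theorem closedDegree_mulEquiv (e : G ≃* H) (x : G) : closedDegree (e x) = closedDegree x := by
  refine (Set.ncard_congr (fun y _ => e y) (fun y => ?_) (fun _ _ _ _ h => e.injective h)
    fun z hz => ⟨e.symm z, ?_, e.apply_symm_apply z⟩).symm
  · simp only [Set.mem_ofPred_eq, mem_zpowers_mulEquiv_iff, imp_self]
  · simpa only [Set.mem_ofPred_eq, ← mem_zpowers_mulEquiv_iff e, e.apply_symm_apply] using hz

theorem closedDegree_congr {x y : G} (h : zpowers x = zpowers y) :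
    closedDegree x = closedDegree y := by
  simp only [closedDegree, ← zpowers_le, h]

theorem ncard_zpowers (x : G) : (zpowers x : Set G).ncard = orderOf x := Nat.card_zpowers x

theorem IsMaximalCyclic.closedDegree_eq {y : G} (hy : IsMaximalCyclic (zpowers y)) :
    closedDegree y = orderOf y := by
  rw [← ncard_zpowers, closedDegree]
  congr 1
  ext z
  exact or_iff_left_of_imp (isMaximalCyclic_zpowers_iff.1 hy z)

theorem IsMaximalCyclic.orderOf_eq_card [IsCyclic G] {y : G} (hy : IsMaximalCyclic (zpowers y)) :
    orderOf y = Nat.card G := by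
  obtain ⟨g, hg⟩ := IsCyclic.exists_generator (α := G)
  exact orderOf_eq_card_of_forall_mem_zpowers fun x =>
    zpowers_le.2 (isMaximalCyclic_zpowers_iff.1 hy g (hg y)) (hg x)

theorem rootCount_one : rootCount (1 : G) = Nat.card G := by
  simp only [rootCount, one_mem, Set.ofPred_true, Set.ncard_univ]

variable [Finite G]

theorem exists_isMaximalCyclic_zpowers (x : G) :
    ∃ w : G, IsMaximalCyclic (zpowers w) ∧ x ∈ zpowers w := by
  obtain ⟨M, hxM, hM⟩ := Set.Finite.exists_le_maximal (s := {H : Subgroup G | IsCyclic H})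
    (Set.toFinite _) (isCyclic_zpowers x)
  obtain ⟨w, rfl⟩ := IsMaximalCyclic.exists_zpowers_eq hM
  exact ⟨w, hM, zpowers_le.1 hxM⟩

variable (G) in
theorem exists_isMinOrderMaximalCyclic_zpowers :
    ∃ y : G, IsMinOrderMaximalCyclic (zpowers y) := by
  obtain ⟨w, hw, -⟩ := exists_isMaximalCyclic_zpowers (1 : G)
  obtain ⟨y, hy, hmin⟩ := Set.exists_min_image {y : G | IsMaximalCyclic (zpowers y)} orderOf
    (Set.toFinite _) ⟨w, hw⟩
  exact ⟨y, isMinOrderMaximalCyclic_zpowers_iff.2 ⟨hy, hmin⟩⟩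

theorem orderOf_le_closedDegree (x : G) : orderOf x ≤ closedDegree x := by
  rw [← ncard_zpowers]
  exact Set.ncard_le_ncard fun _ => Or.inl

theorem rootCount_le_closedDegree (x : G) : rootCount x ≤ closedDegree x :=
  Set.ncard_le_ncard fun _ => Or.inr

theorem mem_zpowers_and_mem_zpowers_iff {x y : G} :
    y ∈ zpowers x ∧ x ∈ zpowers y ↔ y ∈ zpowers x ∧ orderOf y = orderOf x := by
  refine and_congr_right fun hy => ⟨fun hx => ?_, fun h => ?_⟩
  · exact Nat.dvd_antisymm (orderOf_dvd_of_mem_zpowers hy) (orderOf_dvd_of_mem_zpowers hx)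
  · have : zpowers y = zpowers x := eq_of_le_of_card_ge (zpowers_le.2 hy)
      (by rw [Nat.card_zpowers, Nat.card_zpowers, h])
    exact this ▸ mem_zpowers x

theorem ncard_generators_zpowers (x : G) :
    {y | y ∈ zpowers x ∧ x ∈ zpowers y}.ncard = (orderOf x).totient := by
  classical
  have := Fintype.ofFinite G
  have hx : orderOf x = Fintype.card (zpowers x) := Fintype.card_zpowers.symm
  rw [← IsCyclic.card_orderOf_eq_totient (α := zpowers x) hx.dvd, ← Set.ncard_coe_finset,
    ← Set.ncard_image_of_injective _ Subtype.val_injective]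
  congr 1
  ext y
  simp [mem_zpowers_and_mem_zpowers_iff, -Subgroup.exists_zpowers, and_comm]

theorem closedDegree_add_totient (x : G) :
    closedDegree x + (orderOf x).totient = orderOf x + rootCount x := by
  rw [← ncard_generators_zpowers, ← ncard_zpowers]
  exact Set.ncard_union_add_ncard_inter _ _

theorem totient_orderOf_le_rootCount {x w : G} (hx : x ∈ zpowers w) :
    (orderOf w).totient ≤ rootCount x := by
  rw [← ncard_generators_zpowers]
  exact Set.ncard_le_ncard fun y hy => zpowers_le.2 hy.2 hx

end CyclicSubgroups

section PowerGraph

variable {G : Type*} [Group G]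

theorem exists_pos_pow_iff_mem_zpowers [Finite G] {x y : G} :
    (∃ m : ℕ, 0 < m ∧ y = x ^ m) ↔ y ∈ zpowers x := by
  refine ⟨fun ⟨m, _, hm⟩ => hm ▸ npow_mem_zpowers x m, fun h => ?_⟩
  obtain ⟨m, rfl⟩ := mem_powers_iff_mem_zpowers.2 h
  exact ⟨m + orderOf x, by have := orderOf_pos x; omega, by simp [pow_add]⟩

theorem powerGraph_adj_iff [Finite G] {x y : G} :
    (powerGraph G).Adj x y ↔ x ≠ y ∧ (y ∈ zpowers x ∨ x ∈ zpowers y) := by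
  simp only [powerGraph, SimpleGraph.fromRel_adj, exists_pos_pow_iff_mem_zpowers]

variable [Fintype G] [DecidableRel (powerGraph G).Adj]

theorem powerGraph_degree_add_one (x : G) : (powerGraph G).degree x + 1 = closedDegree x := by
  classical
  rw [← SimpleGraph.card_neighborFinset_eq_degree, closedDegree,
    ← Finset.card_insert_of_notMem ((powerGraph G).notMem_neighborFinset_self x),
    ← Set.ncard_coe_finset]
  congr 1
  ext y
  by_cases hxy : y = x
  · simp [hxy]
  · simp [powerGraph_adj_iff, hxy, Ne.symm hxy]

theorem powerGraph_minDegree_eq {y : G} (h : ∀ x : G, closedDegree y ≤ closedDegree x) :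
    (powerGraph G).minDegree = (powerGraph G).degree y := by
  refine le_antisymm ((powerGraph G).minDegree_le_degree y)
    ((powerGraph G).le_minDegree_of_forall_le_degree _ fun x => ?_)
  have := h x
  rw [← powerGraph_degree_add_one, ← powerGraph_degree_add_one] at this
  omega

end PowerGraph

section PGroup

theorem card_comap_le_card_ker_mul_card {G H : Type*} [Group G] [Group H] [Finite H] (f : G →* H)
    (K : Subgroup H) : Nat.card (K.comap f) ≤ Nat.card f.ker * Nat.card K := by
  have hle : f.ker ≤ K.comap f := comap_mono bot_le
  calc Nat.card (K.comap f) = Nat.card f.ker * Nat.card ((K.comap f).map f) := by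
        rw [← relIndex_bot_left, ← relIndex_mul_relIndex _ _ _ bot_le hle, relIndex_bot_left,
          ← f.comap_bot, relIndex_comap, relIndex_bot_left]
    _ ≤ Nat.card f.ker * Nat.card K :=
        Nat.mul_le_mul_left _ (card_le_of_le (map_comap_le f K))

theorem card_ker_powMonoidHom_pow_le {A : Type*} [CommGroup A] [Finite A] (p k : ℕ) :
    Nat.card (powMonoidHom (p ^ k) : A →* A).ker ≤
      Nat.card (powMonoidHom p : A →* A).ker ^ k := by
  induction k with
  | zero =>
    rw [pow_zero, pow_zero, show (powMonoidHom 1 : A →* A).ker = ⊥ by ext; simp, card_bot]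
  | succ k ih =>
    have : (powMonoidHom (p ^ (k + 1)) : A →* A).ker =
        (powMonoidHom (p ^ k) : A →* A).ker.comap (powMonoidHom p) := by
      ext; simp [pow_succ', pow_mul]
    rw [this, pow_succ']
    exact (card_comap_le_card_ker_mul_card _ _).trans (Nat.mul_le_mul_left _ ih)

variable {p : ℕ} [Fact p.Prime]

theorem isCyclic_of_card_ker_powMonoidHom_le {A : Type*} [CommGroup A] [Finite A]
    (hA : IsPGroup p A) (h : Nat.card (powMonoidHom p : A →* A).ker ≤ p) : IsCyclic A := by
  obtain ⟨n, hn⟩ := hA.exists_card_eq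
  obtain ⟨k, -, hk⟩ := (Nat.dvd_prime_pow Fact.out).1 (hn ▸ Group.exponent_dvd_nat_card (G := A))
  have htop : (powMonoidHom (p ^ k) : A →* A).ker = ⊤ := by
    ext a
    simp [← hk, Monoid.pow_exponent_eq_one]
  refine IsCyclic.iff_exponent_eq_card.2 (le_antisymm
    (Nat.le_of_dvd Nat.card_pos Group.exponent_dvd_nat_card) ?_)
  calc Nat.card A = Nat.card (powMonoidHom (p ^ k) : A →* A).ker := by rw [htop, card_top]
    _ ≤ Nat.card (powMonoidHom p : A →* A).ker ^ k := card_ker_powMonoidHom_pow_le p k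
    _ ≤ p ^ k := Nat.pow_le_pow_left h k
    _ = Monoid.exponent A := hk.symm

theorem ncard_mul_of_disjoint {G : Type*} [Group G] {H K : Subgroup G} (h : Disjoint H K)
    {S : Set G} (hS : S ⊆ K) : ((H : Set G) * S).ncard = Nat.card H * S.ncard := by
  have hinj : Set.InjOn (fun a : G × G => a.1 * a.2) ((H : Set G) ×ˢ S) := by
    rintro ⟨c, s⟩ ⟨hc, hs⟩ ⟨d, t⟩ ⟨hd, ht⟩ heq
    have := @mul_injective_of_disjoint _ _ _ _ h (⟨c, hc⟩, ⟨s, hS hs⟩) (⟨d, hd⟩, ⟨t, hS ht⟩) heq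
    simpa using this
  rw [← Set.image_mul_prod, hinj.ncard_image, Set.ncard_prod]
  rfl

theorem disjoint_zpowers_of_notMem {G : Type*} [Group G] {z : G} (hz : z ^ p = 1)
    {H : Subgroup G} (hzH : z ∉ H) : Disjoint (zpowers z) H := by
  have hzp : orderOf z = p := orderOf_eq_prime hz fun h => hzH (h ▸ one_mem H)
  have : Fact (Nat.card (zpowers z)).Prime := ⟨by rw [Nat.card_zpowers, hzp]; exact Fact.out⟩
  rcases (H.subgroupOf (zpowers z)).eq_bot_or_eq_top_of_prime_card with h | h
  · exact (subgroupOf_eq_bot.1 h).symm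
  · exact absurd (subgroupOf_eq_top.1 h (mem_zpowers z)) hzH

theorem pow_gcd_orderOf_mem_zpowers {G : Type*} [Group G] (w : G) (k : ℕ) :
    w ^ (orderOf w).gcd k ∈ zpowers (w ^ k) := by
  refine mem_zpowers_iff.2 ⟨(orderOf w).gcdB k, ?_⟩
  rw [← zpow_natCast w ((orderOf w).gcd k), Nat.gcd_eq_gcd_ab, zpow_add, zpow_mul, zpow_mul]
  simp

variable {Q : Type*} [Group Q] (hQ : IsPGroup p Q)
include hQ

theorem orderOf_dvd_orderOf_of_le {x y : Q} (h : orderOf x ≤ orderOf y) :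
    orderOf x ∣ orderOf y := by
  obtain ⟨k, hk⟩ := IsPGroup.iff_orderOf.1 hQ x
  obtain ⟨j, hj⟩ := IsPGroup.iff_orderOf.1 hQ y
  rw [hk, hj] at h ⊢
  exact pow_dvd_pow p ((Nat.pow_le_pow_iff_right (Fact.out : p.Prime).one_lt).1 h)

theorem mul_orderOf_le_of_orderOf_lt {x y : Q} (h : orderOf x < orderOf y) :
    p * orderOf x ≤ orderOf y := by
  obtain ⟨k, hk⟩ := IsPGroup.iff_orderOf.1 hQ x
  obtain ⟨j, hj⟩ := IsPGroup.iff_orderOf.1 hQ y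
  rw [hk, hj] at h ⊢
  rw [← pow_succ']
  have hp : p.Prime := Fact.out
  exact Nat.pow_le_pow_right hp.pos ((Nat.pow_lt_pow_iff_right hp.one_lt).1 h)

theorem mul_totient_orderOf_add_orderOf {x : Q} (hx : x ≠ 1) :
    p * (orderOf x).totient + orderOf x = p * orderOf x := by
  obtain ⟨k, hk⟩ := IsPGroup.iff_orderOf.1 hQ x
  obtain ⟨k, rfl⟩ : ∃ j, k = j + 1 := Nat.exists_eq_succ_of_ne_zero fun h0 =>
    hx (orderOf_eq_one_iff.1 (by rw [hk, h0, pow_zero]))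
  obtain ⟨q, rfl⟩ : ∃ q, p = q + 1 := ⟨p - 1, (Nat.succ_pred_prime Fact.out).symm⟩
  rw [hk, Nat.totient_prime_pow_succ Fact.out, Nat.add_sub_cancel]
  ring

theorem mul_orderOf_le_mul_totient_add_orderOf (x : Q) :
    p * orderOf x ≤ p * (orderOf x).totient + orderOf x := by
  rcases eq_or_ne x 1 with rfl | hx
  · simp
  · exact (mul_totient_orderOf_add_orderOf hQ hx).ge

variable [Finite Q]

theorem exists_mem_center_notMem_zpowers (hZ : ¬ IsCyclic (center Q)) (w : Q) :
    ∃ z ∈ center Q, z ^ p = 1 ∧ z ∉ zpowers w := by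
  by_contra! h
  let : CommGroup (center Q) := { mul_comm := mul_comm' }
  refine hZ (isCyclic_of_card_ker_powMonoidHom_le (hQ.to_subgroup _) ?_)
  let T : Subgroup (center Q) := (powMonoidHom p : center Q →* center Q).ker
  have hT (z : T) : z ^ p = 1 := Subtype.ext z.2
  have hTw (z : T) : ((z : center Q) : Q) ∈ zpowers w :=
    h z z.1.2 (congrArg Subtype.val (show (z : center Q) ^ p = 1 from z.2))
  have : IsCyclic T := isCyclic_of_injective
    (((center Q).subtype.comp T.subtype).codRestrict (zpowers w) hTw)
    fun a b hab => Subtype.ext (Subtype.ext (congrArg (fun c : zpowers w => (c : Q)) hab))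
  refine Nat.le_of_dvd (Fact.out : p.Prime).pos ?_
  rw [← IsCyclic.exponent_eq_card]
  exact Monoid.exponent_dvd_iff_forall_pow_eq_one.2 hT

theorem mem_zpowers_pow_of_notMem {x s : Q} (hx : x ∈ zpowers s) (hs : s ∉ zpowers x) :
    x ∈ zpowers (s ^ p) := by
  obtain ⟨k, rfl⟩ := mem_powers_iff_mem_zpowers.2 hx
  obtain ⟨n, hn⟩ := IsPGroup.iff_orderOf.1 hQ s
  obtain ⟨j, hj⟩ : p ∣ k := by
    by_contra hpk
    exact hs (mem_zpowers_pow_iff.2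
      (hn ▸ ((Nat.Prime.coprime_iff_not_dvd Fact.out).2 hpk).symm.pow_right n))
  exact mem_zpowers_iff.2 ⟨j, by rw [zpow_natCast, ← pow_mul, hj]⟩

theorem mem_zpowers_or_mem_zpowers {w x y : Q} (hx : x ∈ zpowers w) (hy : y ∈ zpowers w) :
    x ∈ zpowers y ∨ y ∈ zpowers x := by
  obtain ⟨i, rfl⟩ := mem_powers_iff_mem_zpowers.2 hx
  obtain ⟨j, rfl⟩ := mem_powers_iff_mem_zpowers.2 hy
  have hmem {a b : ℕ} (h : (orderOf w).gcd a ∣ (orderOf w).gcd b) : w ^ b ∈ zpowers (w ^ a) := by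
    obtain ⟨c, hc⟩ := h.trans (Nat.gcd_dvd_right _ b)
    rw [hc, pow_mul]
    exact pow_mem (pow_gcd_orderOf_mem_zpowers w a) c
  have hgcd (k : ℕ) : ∃ a, (orderOf w).gcd k = p ^ a := by
    obtain ⟨n, hn⟩ := IsPGroup.iff_orderOf.1 hQ w
    obtain ⟨a, -, ha⟩ := (Nat.dvd_prime_pow Fact.out).1 (hn ▸ (orderOf w).gcd_dvd_left k)
    exact ⟨a, hn ▸ ha⟩
  obtain ⟨a, ha⟩ := hgcd i
  obtain ⟨b, hb⟩ := hgcd j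
  refine (le_total b a).imp (fun h => hmem ?_) fun h => hmem ?_ <;> rw [ha, hb]
  exacts [pow_dvd_pow p h, pow_dvd_pow p h]

theorem totient_add_mul_sub_le_rootCount (hZ : ¬ IsCyclic (center Q)) {x w : Q}
    (hx : x ∈ zpowers w) :
    (orderOf x).totient + p * (orderOf w - orderOf x) ≤ rootCount x := by
  obtain ⟨z, hzZ, hzp, hzw⟩ := exists_mem_center_notMem_zpowers hQ hZ w
  have hz : orderOf z = p := orderOf_eq_prime hzp fun h => hzw (h ▸ one_mem _)
  have hdisj : Disjoint (zpowers z) (zpowers w) := disjoint_zpowers_of_notMem hzp hzw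
  have hxw : zpowers x ≤ zpowers w := zpowers_le.2 hx
  let S : Set Q := (zpowers w : Set Q) \ zpowers x
  have hS : S.ncard = orderOf w - orderOf x := by
    rw [Set.ncard_sdiff hxw, ncard_zpowers, ncard_zpowers]
  have hroot {c s : Q} (hc : c ∈ zpowers z) (hs : s ∈ S) : x ∈ zpowers (c * s) := by
    have hcp : (c * s) ^ p = s ^ p := by
      have hcomm : Commute c s := (mem_center_iff.1 (zpowers_le.2 hzZ hc) s).symm
      have hc1 : c ^ orderOf z = 1 :=
        orderOf_dvd_iff_pow_eq_one.1 (orderOf_dvd_of_mem_zpowers hc)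
      rw [hcomm.mul_pow, ← hz, hc1, one_mul]
    have hxs : x ∈ zpowers s := (mem_zpowers_or_mem_zpowers hQ hx hs.1).resolve_right hs.2
    exact zpowers_le.2 (npow_mem_zpowers (c * s) p) (hcp ▸ mem_zpowers_pow_of_notMem hQ hxs hs.2)
  rw [← ncard_generators_zpowers, ← hS, ← hz, ← Nat.card_zpowers,
    ← ncard_mul_of_disjoint hdisj Set.sdiff_subset, ← Set.ncard_union_eq]
  · refine Set.ncard_le_ncard (Set.union_subset (fun y hy => hy.2) ?_)
    rintro _ ⟨c, hc, s, hs, rfl⟩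
    exact hroot hc hs
  · rw [Set.disjoint_left]
    rintro _ ⟨hcs, -⟩ ⟨c, hc, s, hs, rfl⟩
    have : c = 1 := disjoint_def.1 hdisj hc ((mul_mem_cancel_right hs.1).1 (hxw hcs))
    exact hs.2 (by simpa [this] using hcs)

theorem totient_orderOf_le_of_orderOf_le {x y : Q} (h : orderOf x ≤ orderOf y) :
    (orderOf x).totient ≤ (orderOf y).totient :=
  Nat.le_of_dvd (Nat.totient_pos.2 (orderOf_pos y))
    (Nat.totient_dvd_of_dvd (orderOf_dvd_orderOf_of_le hQ h))

theorem totient_orderOf_le_rootCount_of_isMinOrder {y : Q}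
    (hy : IsMinOrderMaximalCyclic (zpowers y)) (x : Q) :
    (orderOf y).totient ≤ rootCount x := by
  obtain ⟨w, hw, hxw⟩ := exists_isMaximalCyclic_zpowers x
  have hyw := (isMinOrderMaximalCyclic_zpowers_iff.1 hy).2 w hw
  exact (totient_orderOf_le_of_orderOf_le hQ hyw).trans (totient_orderOf_le_rootCount hxw)

theorem totient_add_mul_sub_le_rootCount_of_isMinOrder (hZ : ¬ IsCyclic (center Q)) {y : Q}
    (hy : IsMinOrderMaximalCyclic (zpowers y)) (x : Q) :
    (orderOf x).totient + p * (orderOf y - orderOf x) ≤ rootCount x := by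
  obtain ⟨w, hw, hxw⟩ := exists_isMaximalCyclic_zpowers x
  refine le_trans ?_ (totient_add_mul_sub_le_rootCount hQ hZ hxw)
  gcongr
  exact (isMinOrderMaximalCyclic_zpowers_iff.1 hy).2 w hw

theorem mul_totient_orderOf_le_rootCount (hZ : ¬ IsCyclic (center Q)) {x y : Q}
    (hy : IsMinOrderMaximalCyclic (zpowers y)) (hxy : orderOf x < orderOf y) :
    p * (orderOf y).totient ≤ rootCount x := by
  have hy1 : y ≠ 1 := fun h => (hxy.trans_eq (by rw [h, orderOf_one])).not_ge (orderOf_pos x)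
  have hle := totient_add_mul_sub_le_rootCount_of_isMinOrder hQ hZ hy x
  have hφ := mul_totient_orderOf_add_orderOf hQ hy1
  have hmul := mul_orderOf_le_of_orderOf_lt hQ hxy
  rw [Nat.mul_sub] at hle
  omega

theorem closedDegree_eq_card [IsCyclic Q] (x : Q) : closedDegree x = Nat.card Q := by
  obtain ⟨g, hg⟩ := IsCyclic.exists_generator (α := Q)
  rw [closedDegree, ← Set.ncard_univ]
  congr 1
  exact Set.eq_univ_of_forall fun y => mem_zpowers_or_mem_zpowers hQ (hg y) (hg x)

theorem rootCount_add_orderOf [IsCyclic Q] (x : Q) :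
    rootCount x + orderOf x = Nat.card Q + (orderOf x).totient := by
  rw [add_comm, ← closedDegree_add_totient, closedDegree_eq_card hQ]

theorem sq_mul_card_le_sq_mul_rootCount_add_card [IsCyclic Q] {x : Q}
    (hx : orderOf x < Nat.card Q) :
    p ^ 2 * Nat.card Q ≤ p ^ 2 * rootCount x + Nat.card Q := by
  obtain ⟨g, hg⟩ := IsCyclic.exists_ofOrder_eq_natCard (α := Q)
  have hN := rootCount_add_orderOf hQ x
  have hφ := mul_orderOf_le_mul_totient_add_orderOf hQ x
  have hlt := mul_orderOf_le_of_orderOf_lt hQ (hg ▸ hx)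
  rw [hg] at hlt
  nlinarith

theorem succ_mul_totient_card_le_mul_rootCount [IsCyclic Q] {x : Q}
    (hx : orderOf x < Nat.card Q) :
    (p + 1) * (Nat.card Q).totient ≤ p * rootCount x := by
  obtain ⟨g, hg⟩ := IsCyclic.exists_ofOrder_eq_natCard (α := Q)
  have hg1 : g ≠ 1 := fun h =>
    (hx.trans_eq (by rw [← hg, h, orderOf_one])).not_ge (orderOf_pos x)
  have hφ := mul_totient_orderOf_add_orderOf hQ hg1
  have hsq := sq_mul_card_le_sq_mul_rootCount_add_card hQ hx
  rw [hg] at hφ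
  refine le_of_mul_le_mul_left ?_ (Fact.out : p.Prime).pos
  nlinarith

end PGroup

theorem mul_prod_le_mul_prod {ι M : Type*} [CommMonoid M] [Preorder M] [MulLeftMono M]
    {s : Finset ι} {f g : ι → M} {a b : M} {e : ι} (he : e ∈ s) (hab : a * f e ≤ b * g e)
    (hfg : ∀ i ∈ s, f i ≤ g i) : a * ∏ i ∈ s, f i ≤ b * ∏ i ∈ s, g i := by
  classical
  rw [← Finset.mul_prod_erase _ _ he, ← Finset.mul_prod_erase _ _ he, ← mul_assoc, ← mul_assoc]
  exact mul_le_mul' hab (Finset.prod_le_prod' fun i hi => hfg i (Finset.mem_of_mem_erase hi))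

section Pi

variable {ι : Type*} {P : ι → Type*} [∀ i, Group (P i)] [∀ i, Finite (P i)]
  (hco : Pairwise fun i j => (Nat.card (P i)).Coprime (Nat.card (P j)))
include hco

theorem mem_zpowers_pi_iff [Finite ι] {x y : ∀ i, P i} :
    x ∈ zpowers y ↔ ∀ i, x i ∈ zpowers (y i) := by
  have := Fintype.ofFinite ι
  refine ⟨fun h i => ?_, fun h => ?_⟩
  · obtain ⟨m, rfl⟩ := mem_zpowers_iff.1 h
    exact zpow_mem_zpowers (y i) m
  choose m hm using fun i => mem_powers_iff_mem_zpowers.2 (h i)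
  let k := Nat.chineseRemainderOfFinset m (fun i => orderOf (y i)) Finset.univ
    (fun i _ => (orderOf_pos (y i)).ne')
    (fun i _ j _ hij => (hco hij).of_dvd (orderOf_dvd_natCard _) (orderOf_dvd_natCard _))
  refine mem_powers_iff_mem_zpowers.1 ⟨k.1, funext fun i => ?_⟩
  rw [← hm i]
  exact pow_eq_pow_iff_modEq.2 (k.2 i (Finset.mem_univ i))

section Fintype

variable [Fintype ι]

theorem rootCount_pi (x : ∀ i, P i) : rootCount x = ∏ i, rootCount (x i) := by
  simp only [rootCount, mem_zpowers_pi_iff hco, ← Nat.card_coe_set_eq]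
  rw [← Nat.card_pi]
  exact Nat.card_congr (Equiv.subtypePiEquivPi (p := fun i (y : P i) => x i ∈ zpowers y))

theorem orderOf_pi (x : ∀ i, P i) : orderOf x = ∏ i, orderOf (x i) := by
  simp only [← Nat.card_zpowers]
  rw [← Nat.card_pi]
  exact Nat.card_congr ((Equiv.subtypeEquivRight fun y => mem_zpowers_pi_iff hco).trans
    Equiv.subtypePiEquivPi)

theorem totient_orderOf_pi (x : ∀ i, P i) :
    (orderOf x).totient = ∏ i, (orderOf (x i)).totient := by
  simp only [← ncard_generators_zpowers, mem_zpowers_pi_iff hco, ← Nat.card_coe_set_eq,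
    ← forall_and]
  rw [← Nat.card_pi]
  exact Nat.card_congr (Equiv.subtypePiEquivPi
    (p := fun i (y : P i) => y ∈ zpowers (x i) ∧ x i ∈ zpowers y))

variable [DecidableEq ι]

theorem orderOf_update (x : ∀ i, P i) (c : ι) (w : P c) :
    orderOf (update x c w) = orderOf w * ∏ i ∈ Finset.univ.erase c, orderOf (x i) := by
  rw [orderOf_pi hco, ← Finset.mul_prod_erase _ _ (Finset.mem_univ c), update_self]
  congr 1
  exact Finset.prod_congr rfl fun i hi => by rw [update_of_ne (Finset.ne_of_mem_erase hi)]

theorem orderOf_update_one (x : ∀ i, P i) (c : ι) :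
    orderOf (update x c 1) = ∏ i ∈ Finset.univ.erase c, orderOf (x i) := by
  rw [orderOf_update hco, orderOf_one, one_mul]

theorem totient_orderOf_update_one (x : ∀ i, P i) (c : ι) :
    (orderOf (update x c 1)).totient = ∏ i ∈ Finset.univ.erase c, (orderOf (x i)).totient := by
  rw [totient_orderOf_pi hco, ← Finset.mul_prod_erase _ _ (Finset.mem_univ c), update_self,
    orderOf_one, Nat.totient_one, one_mul]
  exact Finset.prod_congr rfl fun i hi => by rw [update_of_ne (Finset.ne_of_mem_erase hi)]

theorem rootCount_eq_mul_prod_erase (x : ∀ i, P i) (c : ι) :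
    rootCount x = rootCount (x c) * ∏ i ∈ Finset.univ.erase c, rootCount (x i) := by
  rw [rootCount_pi hco]
  exact (Finset.mul_prod_erase _ (fun i => rootCount (x i)) (Finset.mem_univ c)).symm

end Fintype

variable [Finite ι]

theorem isMaximalCyclic_zpowers_pi_iff {y : ∀ i, P i} :
    IsMaximalCyclic (zpowers y) ↔ ∀ i, IsMaximalCyclic (zpowers (y i)) := by
  classical
  simp only [isMaximalCyclic_zpowers_iff, mem_zpowers_pi_iff hco]
  refine ⟨fun h i z hz => ?_, fun h z hz i => h i (z i) (hz i)⟩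
  simpa using h (update y i z) (fun j => by rcases eq_or_ne j i with rfl | hj <;> simp [*]) i

theorem IsMinOrderMaximalCyclic.apply {y : ∀ i, P i} (hy : IsMinOrderMaximalCyclic (zpowers y))
    (i : ι) : IsMinOrderMaximalCyclic (zpowers (y i)) := by
  classical
  have := Fintype.ofFinite ι
  simp only [isMinOrderMaximalCyclic_zpowers_iff, isMaximalCyclic_zpowers_pi_iff hco] at hy ⊢
  refine ⟨hy.1 i, fun w hw => ?_⟩
  have h := hy.2 (update y i w) fun j => by
    rcases eq_or_ne j i with rfl | hj
    · rwa [update_self]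
    · rw [update_of_ne hj]
      exact hy.1 j
  rw [orderOf_update hco, ← update_eq_self i y, orderOf_update hco, update_eq_self] at h
  exact Nat.le_of_mul_le_mul_right h (Finset.prod_pos fun j _ => orderOf_pos _)

variable [DecidableEq ι]

theorem zpowers_pow_card_eq (x : ∀ i, P i) (c : ι) :
    zpowers (x ^ Nat.card (P c)) = zpowers (update x c 1) := by
  refine le_antisymm (zpowers_le.2 ((mem_zpowers_pi_iff hco).2 fun i => ?_))
    (zpowers_le.2 ((mem_zpowers_pi_iff hco).2 fun i => ?_))
  all_goals rw [Pi.pow_apply]; rcases eq_or_ne i c with rfl | hi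
  · rw [pow_card_eq_one']
    exact one_mem _
  · rw [update_of_ne hi]
    exact npow_mem_zpowers _ _
  · rw [update_self]
    exact one_mem _
  · rw [update_of_ne hi, mem_zpowers_pow_iff]
    exact (hco hi.symm).coprime_dvd_right (orderOf_dvd_natCard _)

theorem orderOf_eq_mul_orderOf_update_one (x : ∀ i, P i) (c : ι) :
    orderOf x = orderOf (x c) * orderOf (update x c 1) := by
  have := Fintype.ofFinite ι
  rw [orderOf_update_one hco, orderOf_pi hco]
  exact (Finset.mul_prod_erase _ (fun i => orderOf (x i)) (Finset.mem_univ c)).symm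

theorem totient_orderOf_eq_mul_totient_orderOf_update_one (x : ∀ i, P i) (c : ι) :
    (orderOf x).totient = (orderOf (x c)).totient * (orderOf (update x c 1)).totient := by
  have := Fintype.ofFinite ι
  rw [totient_orderOf_update_one hco, totient_orderOf_pi hco]
  exact (Finset.mul_prod_erase _ (fun i => (orderOf (x i)).totient) (Finset.mem_univ c)).symm

theorem rootCount_mul_totient_update_one_le_rootCount {x z : ∀ i, P i} (c : ι)
    (h : ∀ i, (orderOf (z i)).totient ≤ rootCount (x i)) :
    rootCount (x c) * (orderOf (update z c 1)).totient ≤ rootCount x := by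
  have := Fintype.ofFinite ι
  rw [rootCount_eq_mul_prod_erase hco x c, totient_orderOf_update_one hco]
  exact Nat.mul_le_mul_left _ (Finset.prod_le_prod' fun i _ => h i)

theorem mul_add_mul_le_closedDegree_add (x : ∀ i, P i) (c : ι) :
    orderOf (x c) * orderOf (update x c 1) +
        rootCount (x c) * (orderOf (update x c 1)).totient ≤
      closedDegree x + (orderOf (x c)).totient * (orderOf (update x c 1)).totient := by
  rw [← orderOf_eq_mul_orderOf_update_one hco,
    ← totient_orderOf_eq_mul_totient_orderOf_update_one hco,
    closedDegree_add_totient]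
  exact Nat.add_le_add_left (rootCount_mul_totient_update_one_le_rootCount hco c fun i =>
    totient_orderOf_le_rootCount (mem_zpowers (x i))) _

theorem closedDegree_update_one_add_totient {y : ∀ i, P i} (c : ι)
    (hy : ∀ i, IsMaximalCyclic (zpowers (y i))) :
    closedDegree (update y c 1) + (orderOf (update y c 1)).totient =
      orderOf (update y c 1) + Nat.card (P c) * (orderOf (update y c 1)).totient := by
  have := Fintype.ofFinite ι
  have hroot (i : ι) : rootCount (y i) = (orderOf (y i)).totient := by
    have := closedDegree_add_totient (y i)
    rw [(hy i).closedDegree_eq] at this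
    omega
  rw [closedDegree_add_totient, rootCount_eq_mul_prod_erase hco _ c, update_self, rootCount_one,
    totient_orderOf_update_one hco]
  congr 2
  exact Finset.prod_congr rfl fun i hi => by rw [update_of_ne (Finset.ne_of_mem_erase hi), hroot]

theorem closedDegree_update_one_le_orderOf {y : ∀ i, P i} {c : ι} [IsCyclic (P c)]
    (hy : ∀ i, IsMaximalCyclic (zpowers (y i))) :
    closedDegree (update y c 1) ≤ orderOf y := by
  have hadd := closedDegree_update_one_add_totient hco c hy
  have hle := Nat.totient_le (orderOf (update y c 1))
  have hpos : 0 < Nat.card (P c) := Nat.card_pos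
  rw [orderOf_eq_mul_orderOf_update_one hco y c, (hy c).orderOf_eq_card]
  nlinarith

end Pi

theorem le_mul_totient_of_primeFactors_subset {n k : ℕ} {s : Finset ℕ} (hs : ∀ q ∈ s, q.Prime)
    (hn : n.primeFactors ⊆ s) (h : ∏ q ∈ s, q ≤ k * (∏ q ∈ s, q).totient) :
    n ≤ k * n.totient := by
  have hratio {m : ℕ} (hm : m ≠ 0) :
      m ≤ k * m.totient ↔ 1 ≤ k * ∏ q ∈ m.primeFactors, (1 - (q : ℚ)⁻¹) := by
    rw [← Nat.cast_le (α := ℚ), Nat.cast_mul, Nat.totient_eq_mul_prod_factors, mul_left_comm,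
      le_mul_iff_one_le_right (Nat.cast_pos.2 hm.bot_lt)]
  rcases eq_or_ne n 0 with rfl | hn0
  · exact Nat.zero_le _
  rw [hratio (Finset.prod_ne_zero_iff.2 fun q hq => (hs q hq).ne_zero),
    Nat.primeFactors_prod hs] at h
  refine (hratio hn0).2 (h.trans (mul_le_mul_of_nonneg_left ?_ k.cast_nonneg))
  exact Finset.prod_le_prod_of_subset_of_le_one hn
    (fun q _ => sub_nonneg.2 q.cast_inv_le_one) fun q _ _ => sub_le_self _ (by positivity)

-- In fractions: `N ≥ (1 - 1/p²) m`, `K ≥ (1 + 1/q) F` and `q ≤ p - 1` give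
-- `N K ≥ (1 - 1/p²) (1 + 1/(p - 1)) m F = (1 + 1/p) m F ≥ (1 + 1/m) m F`.
theorem succ_mul_le_mul_of_lt {q p m N K F : ℕ} (hqp : q < p) (hpm : p ≤ m)
    (hK : (q + 1) * F ≤ q * K) (hN : p ^ 2 * m ≤ p ^ 2 * N + m) : (m + 1) * F ≤ N * K := by
  have hFK : F ≤ K := by
    by_contra! h
    nlinarith
  obtain ⟨r, rfl⟩ : ∃ r, p = r + 1 := ⟨p - 1, by omega⟩
  have hK' : (r + 1) * F ≤ r * K := by nlinarith [hFK]
  rcases r.eq_zero_or_pos with rfl | hr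
  · have hF : F = 0 := by omega
    simp [hF]
  have hN' : r * (r + 2) * m ≤ (r + 1) ^ 2 * N := by nlinarith
  have hprod : r * (r + 1) * ((r + 2) * (m * F)) ≤ r * (r + 1) * ((r + 1) * (N * K)) :=
    calc r * (r + 1) * ((r + 2) * (m * F)) = r * (r + 2) * m * ((r + 1) * F) := by ring
      _ ≤ (r + 1) ^ 2 * N * (r * K) := Nat.mul_le_mul hN' hK'
      _ = r * (r + 1) * ((r + 1) * (N * K)) := by ring
  have hNK := Nat.le_of_mul_le_mul_left hprod (by positivity)
  refine Nat.le_of_mul_le_mul_left (c := r + 1) (hNK.trans' ?_) (by omega)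
  calc (r + 1) * ((m + 1) * F) = (r + 1) * m * F + (r + 1) * F := by ring
    _ ≤ (r + 1) * m * F + m * F := Nat.add_le_add_left (Nat.mul_le_mul_right F hpm) _
    _ = (r + 2) * (m * F) := by ring

section PiOfPGroups

variable {ι : Type*} {P : ι → Type*} [∀ i, Group (P i)] {p : ι → ℕ} [∀ i, Fact (p i).Prime]

theorem primeFactors_orderOf_subset (hP : ∀ i, IsPGroup (p i) (P i))
    {x : ∀ i, P i} {s : Finset ι} (hx : ∀ i ∉ s, x i = 1) :
    (orderOf x).primeFactors ⊆ s.image p := by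
  intro q hq
  have hqp := Nat.prime_of_mem_primeFactors hq
  have hdvd : orderOf x ∣ ∏ i ∈ s, orderOf (x i) := by
    refine orderOf_dvd_of_pow_eq_one (funext fun i => orderOf_dvd_iff_pow_eq_one.1 ?_)
    by_cases hi : i ∈ s
    · exact Finset.dvd_prod_of_mem _ hi
    · rw [hx i hi, orderOf_one]
      exact one_dvd _
  obtain ⟨i, hi, hqi⟩ :=
    (hqp.prime.dvd_finsetProd_iff _).1 ((Nat.dvd_of_mem_primeFactors hq).trans hdvd)
  obtain ⟨k, hk⟩ := IsPGroup.iff_orderOf.1 (hP i) (x i)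
  have hqpi : q = p i := (Nat.prime_dvd_prime_iff_eq hqp Fact.out).1
    (hqp.dvd_of_dvd_pow (hk ▸ hqi))
  exact Finset.mem_image.2 ⟨i, hi, hqpi.symm⟩

theorem orderOf_le_mul_totient_orderOf (hP : ∀ i, IsPGroup (p i) (P i)) (hp : p.Injective)
    {x : ∀ i, P i} {s : Finset ι} {k : ℕ} (hx : ∀ i ∉ s, x i = 1)
    (hs : ∏ i ∈ s, p i ≤ k * (∏ i ∈ s, p i).totient) :
    orderOf x ≤ k * (orderOf x).totient := by
  classical
  refine le_mul_totient_of_primeFactors_subset (s := s.image p) ?_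
    (primeFactors_orderOf_subset hP hx) ?_
  · simp only [Finset.forall_mem_image]
    exact fun i _ => Fact.out
  · rwa [Finset.prod_image hp.injOn]

variable [∀ i, Finite (P i)]

theorem pairwise_coprime_card (hP : ∀ i, IsPGroup (p i) (P i)) (hp : p.Injective) :
    Pairwise fun i j => (Nat.card (P i)).Coprime (Nat.card (P j)) :=
  fun i j hij => by
    obtain ⟨m, hm⟩ := (hP i).exists_card_eq
    obtain ⟨n, hn⟩ := (hP j).exists_card_eq
    rw [hm, hn]
    exact ((Nat.coprime_primes Fact.out Fact.out).2 (hp.ne hij)).pow m n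

variable [Finite ι] [DecidableEq ι] (hP : ∀ i, IsPGroup (p i) (P i)) (hp : p.Injective)
  {y : ∀ i, P i} (hy : ∀ i, IsMinOrderMaximalCyclic (zpowers (y i)))
include hP hp

theorem orderOf_update_one_le {x y : ∀ i, P i} {c : ι}
    (h : ∀ i ≠ c, orderOf (x i) ≤ orderOf (y i)) :
    orderOf (update x c 1) ≤ orderOf (update y c 1) := by
  have := Fintype.ofFinite ι
  have hco := pairwise_coprime_card hP hp
  rw [orderOf_update_one hco, orderOf_update_one hco]
  exact Finset.prod_le_prod' fun i hi => h i (Finset.ne_of_mem_erase hi)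

theorem totient_orderOf_update_one_le {x y : ∀ i, P i} {c : ι}
    (h : ∀ i ≠ c, orderOf (x i) ≤ orderOf (y i)) :
    (orderOf (update x c 1)).totient ≤ (orderOf (update y c 1)).totient := by
  have := Fintype.ofFinite ι
  have hco := pairwise_coprime_card hP hp
  rw [totient_orderOf_update_one hco, totient_orderOf_update_one hco]
  exact Finset.prod_le_prod' fun i hi =>
    totient_orderOf_le_of_orderOf_le (hP i) (h i (Finset.ne_of_mem_erase hi))

theorem closedDegree_update_one_eq {y z : ∀ i, P i}
    (hy : ∀ i, IsMinOrderMaximalCyclic (zpowers (y i)))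
    (hz : ∀ i, IsMinOrderMaximalCyclic (zpowers (z i))) (c : ι) :
    closedDegree (update y c 1) = closedDegree (update z c 1) := by
  have := Fintype.ofFinite ι
  have hco := pairwise_coprime_card hP hp
  have hyz (i : ι) : orderOf (y i) = orderOf (z i) := by
    have hyi := isMinOrderMaximalCyclic_zpowers_iff.1 (hy i)
    have hzi := isMinOrderMaximalCyclic_zpowers_iff.1 (hz i)
    exact le_antisymm (hyi.2 _ hzi.1) (hzi.2 _ hyi.1)
  have hord : orderOf (update y c 1) = orderOf (update z c 1) := by
    simp only [orderOf_update_one hco, hyz]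
  have hycd := closedDegree_update_one_add_totient hco c fun i => (hy i).1
  have hzcd := closedDegree_update_one_add_totient hco c fun i => (hz i).1
  rw [hord] at hycd
  omega

include hy

omit [DecidableEq ι] in
theorem mul_totient_orderOf_le_rootCount_pi {x : ∀ i, P i} {l : ι}
    (hZ : ¬ IsCyclic (center (P l))) (hl : orderOf (x l) < orderOf (y l)) :
    p l * (orderOf y).totient ≤ rootCount x := by
  classical
  have hco := pairwise_coprime_card hP hp
  calc p l * (orderOf y).totient
      = p l * (orderOf (y l)).totient * (orderOf (update y l 1)).totient := by
        rw [totient_orderOf_eq_mul_totient_orderOf_update_one hco y l, mul_assoc]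
    _ ≤ rootCount (x l) * (orderOf (update y l 1)).totient :=
        Nat.mul_le_mul_right _ (mul_totient_orderOf_le_rootCount (hP l) hZ (hy l) hl)
    _ ≤ rootCount x := rootCount_mul_totient_update_one_le_rootCount hco l fun i =>
        totient_orderOf_le_rootCount_of_isMinOrder (hP i) (hy i) (x i)

theorem orderOf_le_rootCount_of_two_lt {x : ∀ i, P i} {l : ι}
    (hZ : ¬ IsCyclic (center (P l))) (hl : orderOf (x l) < orderOf (y l)) (hpl : 2 < p l)
    (hφ : orderOf (update y l 1) ≤ 2 * (orderOf (update y l 1)).totient) :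
    orderOf y ≤ rootCount x := by
  have hco := pairwise_coprime_card hP hp
  have hyl : y l ≠ 1 := fun h => by
    rw [h, orderOf_one] at hl
    exact hl.not_ge (orderOf_pos (x l))
  have htot : 2 * orderOf (y l) ≤ p l * (orderOf (y l)).totient := by
    have := mul_totient_orderOf_add_orderOf (hP l) hyl
    nlinarith
  calc orderOf y = orderOf (y l) * orderOf (update y l 1) :=
        orderOf_eq_mul_orderOf_update_one hco y l
    _ ≤ orderOf (y l) * (2 * (orderOf (update y l 1)).totient) := Nat.mul_le_mul_left _ hφ
    _ = 2 * orderOf (y l) * (orderOf (update y l 1)).totient := by ring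
    _ ≤ p l * (orderOf (y l)).totient * (orderOf (update y l 1)).totient :=
        Nat.mul_le_mul_right _ htot
    _ = p l * (orderOf y).totient := by
        rw [totient_orderOf_eq_mul_totient_orderOf_update_one hco y l, mul_assoc]
    _ ≤ rootCount x := mul_totient_orderOf_le_rootCount_pi hP hp hy hZ hl

theorem orderOf_le_closedDegree_of_forall_ne {x : ∀ i, P i} {l : ι}
    (hZ : ¬ IsCyclic (center (P l))) (hx : ∀ i ≠ l, orderOf (y i) ≤ orderOf (x i))
    (hφ : orderOf (update x l 1) ≤ 2 * (orderOf (update x l 1)).totient) :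
    orderOf y ≤ closedDegree x := by
  have hco := pairwise_coprime_card hP hp
  have hcd := mul_add_mul_le_closedDegree_add hco x l
  have hroot := totient_add_mul_sub_le_rootCount_of_isMinOrder (hP l) hZ (hy l) (x l)
  have hle := orderOf_update_one_le hP hp hx
  have hmul : (orderOf (x l)).totient + 2 * (orderOf (y l) - orderOf (x l)) ≤ rootCount (x l) :=
    hroot.trans' (by gcongr; exact (Fact.out : (p l).Prime).two_le)
  refine Nat.le_of_add_le_add_right (b := (orderOf (x l)).totient *
    (orderOf (update x l 1)).totient) (hcd.trans' ?_)
  calc orderOf y + (orderOf (x l)).totient * (orderOf (update x l 1)).totient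
      ≤ (orderOf (x l) + (orderOf (y l) - orderOf (x l))) * orderOf (update x l 1) +
          (orderOf (x l)).totient * (orderOf (update x l 1)).totient := by
        rw [orderOf_eq_mul_orderOf_update_one hco y l]
        gcongr
        exact le_add_tsub
    _ ≤ orderOf (x l) * orderOf (update x l 1) +
          (orderOf (y l) - orderOf (x l)) * (2 * (orderOf (update x l 1)).totient) +
          (orderOf (x l)).totient * (orderOf (update x l 1)).totient := by
        rw [add_mul]
        gcongr
    _ = orderOf (x l) * orderOf (update x l 1) +
          ((orderOf (x l)).totient + 2 * (orderOf (y l) - orderOf (x l))) *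
            (orderOf (update x l 1)).totient := by ring
    _ ≤ orderOf (x l) * orderOf (update x l 1) +
          rootCount (x l) * (orderOf (update x l 1)).totient := by gcongr

omit [DecidableEq ι] in
theorem orderOf_le_closedDegree_of_isMinOrder (hZ : ∀ i, ¬ IsCyclic (center (P i)))
    (hφ : ∀ l (x : ∀ i, P i), x l = 1 → orderOf x ≤ 2 * (orderOf x).totient) (x : ∀ i, P i) :
    orderOf y ≤ closedDegree x := by
  classical
  have := Fintype.ofFinite ι
  have hco := pairwise_coprime_card hP hp
  by_cases hlarge : ∀ i, orderOf (y i) ≤ orderOf (x i)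
  · rw [orderOf_pi hco]
    refine (Finset.prod_le_prod' fun i _ => hlarge i).trans ?_
    rw [← orderOf_pi hco]
    exact orderOf_le_closedDegree x
  push Not at hlarge
  obtain ⟨l, hl⟩ := hlarge
  have hφl (z : ∀ i, P i) (l : ι) := hφ l (update z l 1) (update_self l 1 z)
  by_cases hne : ∀ i ≠ l, orderOf (y i) ≤ orderOf (x i)
  · exact orderOf_le_closedDegree_of_forall_ne hP hp hy (hZ l) hne (hφl x l)
  push Not at hne
  obtain ⟨k, hkl, hk⟩ := hne
  refine le_trans ?_ (rootCount_le_closedDegree x)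
  rcases (Fact.out : (p l).Prime).two_le.lt_or_eq with hpl | hpl
  · exact orderOf_le_rootCount_of_two_lt hP hp hy (hZ l) hl hpl (hφl y l)
  · have hpk : 2 < p k := (Fact.out : (p k).Prime).two_le.lt_of_ne (hpl ▸ hp.ne hkl.symm)
    exact orderOf_le_rootCount_of_two_lt hP hp hy (hZ k) hk hpk (hφl y k)

theorem closedDegree_update_one_le_of_not_isCyclic {x : ∀ i, P i} {c l : ι} [IsCyclic (P c)]
    (hZ : ¬ IsCyclic (center (P l))) (hl : orderOf (x l) < orderOf (y l))
    (hφ : orderOf y ≤ 2 * (orderOf y).totient) :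
    closedDegree (update y c 1) ≤ closedDegree x :=
  calc closedDegree (update y c 1)
      ≤ orderOf y :=
        closedDegree_update_one_le_orderOf (pairwise_coprime_card hP hp) fun i => (hy i).1
    _ ≤ 2 * (orderOf y).totient := hφ
    _ ≤ p l * (orderOf y).totient := Nat.mul_le_mul_right _ (Fact.out : (p l).Prime).two_le
    _ ≤ rootCount x := mul_totient_orderOf_le_rootCount_pi hP hp hy hZ hl
    _ ≤ closedDegree x := rootCount_le_closedDegree x

theorem closedDegree_update_one_le_of_forall_ne {x : ∀ i, P i} {c : ι} [IsCyclic (P c)]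
    (hx : ∀ i ≠ c, orderOf (y i) ≤ orderOf (x i)) :
    closedDegree (update y c 1) ≤ closedDegree x := by
  have hco := pairwise_coprime_card hP hp
  have hcy := closedDegree_update_one_add_totient hco c fun i => (hy i).1
  have hcx := mul_add_mul_le_closedDegree_add hco x c
  have hroot := rootCount_add_orderOf (hP c) (x c)
  have hord := orderOf_update_one_le hP hp hx
  have htot := totient_orderOf_update_one_le hP hp hx
  have hφ := Nat.totient_le (orderOf (update x c 1))
  have hpos := orderOf_pos (x c)
  obtain ⟨k, hk⟩ : ∃ k, Nat.card (P c) = k + 1 := Nat.exists_eq_succ_of_ne_zero Nat.card_pos.ne'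
  rw [hk] at hcy hroot
  calc closedDegree (update y c 1)
      = orderOf (update y c 1) + k * (orderOf (update y c 1)).totient := by linarith
    _ ≤ orderOf (update x c 1) + k * (orderOf (update x c 1)).totient := by gcongr
    _ ≤ closedDegree x := by nlinarith

theorem closedDegree_update_one_le_of_lt {x : ∀ i, P i} {c e : ι} [IsCyclic (P c)]
    [IsCyclic (P e)] (hec : p e < p c) (hc : orderOf (x c) < orderOf (y c))
    (he : orderOf (x e) < orderOf (y e))
    (hφ : orderOf (update y c 1) ≤ 2 * (orderOf (update y c 1)).totient) :
    closedDegree (update y c 1) ≤ closedDegree x := by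
  have := Fintype.ofFinite ι
  have hco := pairwise_coprime_card hP hp
  have hcy := closedDegree_update_one_add_totient hco c fun i => (hy i).1
  have hK : (p e + 1) * (orderOf (update y c 1)).totient ≤
      p e * ∏ i ∈ Finset.univ.erase c, rootCount (x i) := by
    rw [totient_orderOf_update_one hco]
    have hmem : e ∈ Finset.univ.erase c := by simp [ne_of_apply_ne p hec.ne]
    refine mul_prod_le_mul_prod hmem ?_ fun i _ =>
      totient_orderOf_le_rootCount_of_isMinOrder (hP i) (hy i) (x i)
    rw [(hy e).1.orderOf_eq_card] at he ⊢
    exact succ_mul_totient_card_le_mul_rootCount (hP e) he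
  have hpc : p c ≤ Nat.card (P c) := by
    rw [← (hy c).1.orderOf_eq_card]
    exact (Nat.le_mul_of_pos_right _ (orderOf_pos _)).trans (mul_orderOf_le_of_orderOf_lt (hP c) hc)
  have hN := sq_mul_card_le_sq_mul_rootCount_add_card (hP c) ((hy c).1.orderOf_eq_card ▸ hc)
  calc closedDegree (update y c 1)
      ≤ (Nat.card (P c) + 1) * (orderOf (update y c 1)).totient := by linarith
    _ ≤ rootCount (x c) * ∏ i ∈ Finset.univ.erase c, rootCount (x i) :=
        succ_mul_le_mul_of_lt hec hpc hK hN
    _ = rootCount x := (rootCount_eq_mul_prod_erase hco x c).symm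
    _ ≤ closedDegree x := rootCount_le_closedDegree x

theorem exists_isCyclic_closedDegree_update_one_le
    (hZ : ∀ i, ¬ IsCyclic (P i) → ¬ IsCyclic (center (P i))) (hcyc : ∃ c, IsCyclic (P c))
    (hφ : ∀ x : ∀ i, P i, orderOf x ≤ 2 * (orderOf x).totient) (x : ∀ i, P i) :
    ∃ c, IsCyclic (P c) ∧ closedDegree (update y c 1) ≤ closedDegree x := by
  obtain ⟨c, hc⟩ := hcyc
  by_cases hsmall : ∀ i, orderOf (x i) < orderOf (y i) → IsCyclic (P i)
  swap
  · push Not at hsmall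
    obtain ⟨l, hl, hcl⟩ := hsmall
    exact ⟨c, hc, closedDegree_update_one_le_of_not_isCyclic hP hp hy (hZ l hcl) hl (hφ y)⟩
  by_contra! hlt
  have hother {c : ι} (hc : IsCyclic (P c)) : ∃ i ≠ c, orderOf (x i) < orderOf (y i) := by
    by_contra! hx
    exact (hlt c hc).not_ge (closedDegree_update_one_le_of_forall_ne hP hp hy hx)
  obtain ⟨d, -, hd⟩ := hother hc
  obtain ⟨e, hed, he⟩ := hother (hsmall d hd)
  have := hsmall d hd
  have := hsmall e he
  rcases (hp.ne hed).lt_or_gt with h | h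
  · exact (hlt d ‹_›).not_ge (closedDegree_update_one_le_of_lt hP hp hy h hd he (hφ _))
  · exact (hlt e ‹_›).not_ge (closedDegree_update_one_le_of_lt hP hp hy h he hd (hφ _))

omit hy in
theorem exists_isCyclic_forall_closedDegree_update_one_le
    (hZ : ∀ i, ¬ IsCyclic (P i) → ¬ IsCyclic (center (P i))) (hcyc : ∃ c, IsCyclic (P c))
    (hφ : ∀ x : ∀ i, P i, orderOf x ≤ 2 * (orderOf x).totient) :
    ∃ c, IsCyclic (P c) ∧ ∀ y : ∀ i, P i, (∀ i, IsMinOrderMaximalCyclic (zpowers (y i))) →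
      ∀ x : ∀ i, P i, closedDegree (update y c 1) ≤ closedDegree x := by
  choose z hz using fun i => exists_isMinOrderMaximalCyclic_zpowers (P i)
  obtain ⟨c, hc, hmin⟩ := Set.exists_min_image {c | IsCyclic (P c)}
    (fun c => closedDegree (update z c 1)) (Set.toFinite _) hcyc
  refine ⟨c, hc, fun y hy x => ?_⟩
  obtain ⟨d, hd, hdx⟩ := exists_isCyclic_closedDegree_update_one_le hP hp hz hZ hcyc hφ x
  rw [closedDegree_update_one_eq hP hp hy hz c]
  exact (hmin d hd).trans hdx


end PiOfPGroups

section NilpotentGroup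

variable {G : Type*} [Group G] {ι : Type*} {P : ι → Type*}
  [∀ i, Group (P i)] [∀ i, Finite (P i)] {p : ι → ℕ} [∀ i, Fact (p i).Prime]

theorem isMinOrderMaximalCyclic_zpowers_apply [Finite ι] (e : G ≃* ∀ i, P i)
    (hP : ∀ i, IsPGroup (p i) (P i)) (hp : p.Injective) {y : G}
    (hy : IsMinOrderMaximalCyclic (zpowers y)) (i : ι) :
    IsMinOrderMaximalCyclic (zpowers (e y i)) :=
  ((isMinOrderMaximalCyclic_zpowers_mulEquiv_iff e).2 hy).apply (pairwise_coprime_card hP hp) i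

variable [Fintype ι] [Fintype G] [DecidableRel (powerGraph G).Adj]

theorem minDegree_eq_degree_of_isMinOrder [DecidableEq ι] (e : G ≃* ∀ i, P i)
    (hP : ∀ i, IsPGroup (p i) (P i)) (hp : p.Injective)
    (hZ : ∀ i, ¬ IsCyclic (center (P i)))
    (hφ : ∀ l, ∏ i ∈ Finset.univ.erase l, p i ≤
      2 * (∏ i ∈ Finset.univ.erase l, p i).totient)
    {y : G} (hy : IsMinOrderMaximalCyclic (zpowers y)) :
    (powerGraph G).minDegree = (powerGraph G).degree y := by
  refine powerGraph_minDegree_eq fun x => ?_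
  rw [hy.1.closedDegree_eq, ← closedDegree_mulEquiv e, ← e.orderOf_eq]
  refine orderOf_le_closedDegree_of_isMinOrder hP hp
    (isMinOrderMaximalCyclic_zpowers_apply e hP hp hy) hZ (fun l z hz => ?_) (e x)
  refine orderOf_le_mul_totient_orderOf hP hp (fun i hi => ?_) (hφ l)
  rwa [show i = l by simpa using hi]

theorem exists_isCyclic_minDegree_eq_degree_pow (e : G ≃* ∀ i, P i)
    (hP : ∀ i, IsPGroup (p i) (P i)) (hp : p.Injective)
    (hZ : ∀ i, ¬ IsCyclic (P i) → ¬ IsCyclic (center (P i))) (hcyc : ∃ c, IsCyclic (P c))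
    (hφ : ∏ i, p i ≤ 2 * (∏ i, p i).totient) :
    ∃ c, IsCyclic (P c) ∧ ∀ y : G, IsMinOrderMaximalCyclic (zpowers y) →
      (powerGraph G).minDegree = (powerGraph G).degree (y ^ Nat.card (P c)) := by
  classical
  obtain ⟨c, hc, hmin⟩ := exists_isCyclic_forall_closedDegree_update_one_le hP hp hZ hcyc fun x =>
    orderOf_le_mul_totient_orderOf hP hp (fun i hi => absurd (Finset.mem_univ i) hi) hφ
  refine ⟨c, hc, fun y hy => powerGraph_minDegree_eq fun x => ?_⟩
  rw [← closedDegree_mulEquiv e, ← closedDegree_mulEquiv e, map_pow,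
    closedDegree_congr (zpowers_pow_card_eq (pairwise_coprime_card hP hp) (e y) c)]
  exact hmin (e y) (isMinOrderMaximalCyclic_zpowers_apply e hP hp hy) (e x)

end NilpotentGroup

section Sylow

variable {G : Type*} [Group G]

theorem noncyclicPrimes_subset : noncyclicPrimes G ⊆ (Nat.card G).primeFactors := by
  classical exact Finset.filter_subset _ _

theorem mem_noncyclicPrimes_iff [Finite G] {q : ℕ} (hq : q ∈ (Nat.card G).primeFactors)
    (S : Sylow q G) : q ∈ noncyclicPrimes G ↔ ¬ IsCyclic (S : Subgroup G) := by
  have : Fact q.Prime := ⟨Nat.prime_of_mem_primeFactors hq⟩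
  classical
  rw [noncyclicPrimes, Finset.mem_filter, and_iff_right hq]
  exact ⟨fun ⟨T, hT⟩ => (T.equiv S).isCyclic.not.1 hT, fun h => ⟨S, h⟩⟩

theorem nonempty_mulEquiv_pi_sylow [Finite G] (hnil : Group.IsNilpotent G)
    (S : ∀ q : (Nat.card G).primeFactors, Sylow q G) :
    Nonempty (G ≃* ∀ q, (S q : Subgroup G)) := by
  obtain ⟨e⟩ := ((Group.isNilpotent_of_finite_tfae (G := G)).out 0 4).1 hnil
  refine ⟨e.symm.trans (MulEquiv.piCongrRight fun q => ?_)⟩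
  have : Fact (q : ℕ).Prime := ⟨Nat.prime_of_mem_primeFactors q.2⟩
  let := Sylow.unique_of_normal (S q) inferInstance
  let : Unique (Sylow q G) := ⟨⟨S q⟩, fun _ => Subsingleton.elim _ _⟩
  exact MulEquiv.piUnique _

end Sylow

theorem theorem1p2_general {G : Type*} [Group G] [Fintype G] [DecidableRel (powerGraph G).Adj]
    (hnil : Group.IsNilpotent G)
    (hZ : ∀ p ∈ noncyclicPrimes G, ∀ P : Sylow p G, ¬ IsCyclic (center (P : Subgroup G))) :
    (noncyclicPrimes G ≠ (Nat.card G).primeFactors →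
      ∏ p ∈ (Nat.card G).primeFactors, p ≤
        2 * Nat.totient (∏ p ∈ (Nat.card G).primeFactors, p) →
      ∃ q ∈ (Nat.card G).primeFactors \ noncyclicPrimes G,
        ∀ y : G, IsMinOrderMaximalCyclic (zpowers y) →
          (powerGraph G).minDegree =
            (powerGraph G).degree (y ^ (q ^ (Nat.card G).factorization q))) ∧
    (noncyclicPrimes G = (Nat.card G).primeFactors →
      (∀ l ∈ (Nat.card G).primeFactors,
        ∏ p ∈ (Nat.card G).primeFactors.erase l, p ≤
          2 * Nat.totient (∏ p ∈ (Nat.card G).primeFactors.erase l, p)) →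
      ∀ y : G, IsMinOrderMaximalCyclic (zpowers y) →
        (powerGraph G).minDegree = (powerGraph G).degree y) := by
  let S (q : (Nat.card G).primeFactors) : Sylow q G := default
  have hprime (q : (Nat.card G).primeFactors) : Fact (q : ℕ).Prime :=
    ⟨Nat.prime_of_mem_primeFactors q.2⟩
  have hP (q : (Nat.card G).primeFactors) : IsPGroup q (S q : Subgroup G) := (S q).isPGroup'
  have hp : Function.Injective ((↑) : (Nat.card G).primeFactors → ℕ) := Subtype.val_injective
  have hmem (q : (Nat.card G).primeFactors) := mem_noncyclicPrimes_iff q.2 (S q)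
  obtain ⟨e⟩ := nonempty_mulEquiv_pi_sylow hnil S
  refine ⟨fun hne hφ => ?_, fun heq hφ y hy => ?_⟩
  · have hcyc : ∃ c, IsCyclic (S c : Subgroup G) := by
      by_contra! h
      exact hne (noncyclicPrimes_subset.antisymm fun q hq => (hmem ⟨q, hq⟩).2 (h ⟨q, hq⟩))
    rw [← Finset.prod_coe_sort] at hφ
    obtain ⟨c, hc, hdeg⟩ := exists_isCyclic_minDegree_eq_degree_pow e hP hp
      (fun q hq => hZ q ((hmem q).2 hq) (S q)) hcyc hφ
    refine ⟨c, Finset.mem_sdiff.2 ⟨c.2, fun h => (hmem c).1 h hc⟩, fun y hy => ?_⟩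
    rw [hdeg y hy, (S c).card_eq_multiplicity]
  · refine minDegree_eq_degree_of_isMinOrder e hP hp
      (fun q => hZ q (heq.symm.subset q.2) (S q)) (fun l => ?_) hy
    rw [Finset.univ_eq_attach, Finset.prod_erase_attach (fun q => q)]
    exact hφ l l.2

theorem theorem1p2 {G : Type*} [Group G] [Fintype G] [DecidableRel (powerGraph G).Adj]
    (hnil : Group.IsNilpotent G) (hnc : ¬ IsCyclic G)
    (hr : 2 ≤ (Nat.card G).primeFactors.card)
    (hZ : ∀ p ∈ noncyclicPrimes G, ∀ P : Sylow p G,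
      ¬ IsCyclic (Subgroup.center (P : Subgroup G))) :
    (noncyclicPrimes G ≠ (Nat.card G).primeFactors →
      ∏ p ∈ (Nat.card G).primeFactors, p ≤
        2 * Nat.totient (∏ p ∈ (Nat.card G).primeFactors, p) →
      ∃ q ∈ (Nat.card G).primeFactors \ noncyclicPrimes G,
        ∀ y : G, IsMinOrderMaximalCyclic (Subgroup.zpowers y) →
          (powerGraph G).minDegree =
            (powerGraph G).degree (y ^ (q ^ (Nat.card G).factorization q))) ∧
    (noncyclicPrimes G = (Nat.card G).primeFactors →
      (∀ l ∈ (Nat.card G).primeFactors,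
        ∏ p ∈ (Nat.card G).primeFactors.erase l, p ≤
          2 * Nat.totient (∏ p ∈ (Nat.card G).primeFactors.erase l, p)) →
      ∀ y : G, IsMinOrderMaximalCyclic (Subgroup.zpowers y) →
        (powerGraph G).minDegree = (powerGraph G).degree y) :=
  theorem1p2_general hnil hZ
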